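/- Let $n\ge 2$ and $k\ge 2$ be integers. A $k$-Pell string is a string over the alphabet $\{0,1,\dots,k-1,kk\}$, where the symbol $kk$ counts as two positions. The $k$-Pell graph $\Pi_{n,k}$ has as vertices the $k$-Pell strings of length $n$; two of them are adjacent whenever one is obtained from the other by replacing a letter $i\in\{0,\dots,k-2\}$ with $i+1$, or by replacing one factor $(k-1)(k-1)$ with $kk$. The center $C(G)$ of a graph $G$ is the set of vertices whose eccentricity equals the radius of $G$. The Fibonacci cube $\Gamma_n$ is the graph on the binary strings of length $n$ without two consecutive $1$s, two strings being adjacent when they differ in exactly one coordinate. $F_m$ are the Fibonacci numbers, $F_0=0$, $F_1=1$. Define the following sets of words. - For $k$ even, $\Theta_n(k)$ is the set of words of length $n$ over $\{\frac k2-1,\frac k2\}$ with no two consecutive letters $\frac k2-1$. - For $n$ even, $\Phi_n(a,b)$ is the set of strings of length $n$ that are words over the alphabet $\{aa,ab,ba\}$ in which the letter $ba$ never appears (at any distance) before the letter $ab$. - For $n$ odd, $\Psi_n(a,b)$ is the set of words of length $n$ over $\{a,b\}$ that start and end with $a$, contain no factor $bb$, and in which all runs (maximal blocks) of $a$ have odd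 length. **Theorem.** For all $n\ge2$ and $k\ge2$, $$C(\Pi_{n,k})=\begin{cases}\Theta_n(k), & k\text{ even},\\ \Phi_n\left(\frac{k-1}2,\frac{k+1}2\right), & k\text{ odd and } n\text{ even},\\ \Psi_n\left(\frac{k-1}2,\frac{k+1}2\right), & k\text{ odd and } n\text{ odd},\end{cases}$$ and $$|C(\Pi_{n,k})|=\begin{cases}F_{n+2}, & k\text{ even},\\ (n+4)\,2^{\frac n2-2}, & k\text{ odd and } n\text{ even},\\ 2^{\frac{n-1}2}, & k\text{ odd and } n\text{ odd}.\end{cases}$$ Moreover, if $k$ is even, then the subgraph of $\Pi_{n,k}$ induced by $C(\Pi_{n,k})$ is isomorphic to $\Gamma_n$. -/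

import Mathlib

namespace KPell

/-- `k`-Pell strings: words over the alphabet `{0, 1, …, k-1, kk}`, where the last symbol `kk`
occupies two positions of the string. -/
inductive IsPellString (k : ℕ) : List ℕ → Prop
  | nil : IsPellString k []
  | cons {i : ℕ} {t : List ℕ} : i < k → IsPellString k t → IsPellString k (i :: t)
  | double {t : List ℕ} : IsPellString k t → IsPellString k (k :: k :: t)

/-- The set of `k`-Pell strings of length `n`. -/
def pellStrings (n k : ℕ) : Set (List ℕ) :=
  {t | IsPellString k t ∧ t.length = n}

/-- `t` arises from `s` by replacing one letter `i ∈ {0, …, k-2}` with `i + 1`, or by replacing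
one factor `(k-1)(k-1)` with `kk`. -/
def PellStep (k : ℕ) (s t : List ℕ) : Prop :=
  (∃ (u v : List ℕ) (i : ℕ), i + 2 ≤ k ∧ s = u ++ [i] ++ v ∧ t = u ++ [i + 1] ++ v) ∨
  (∃ u v : List ℕ, s = u ++ [k - 1, k - 1] ++ v ∧ t = u ++ [k, k] ++ v)

/-- The `k`-Pell graph `Π_{n,k}`. -/
def pellGraph (n k : ℕ) : SimpleGraph (pellStrings n k) :=
  SimpleGraph.fromRel fun s t => PellStep k s.1 t.1

/-- Fibonacci strings of length `n`: binary strings with no two consecutive `1`s. -/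
def fibStrings (n : ℕ) : Set (List Bool) :=
  {w | w.length = n ∧ ¬ [true, true] <:+: w}

/-- The Fibonacci cube `Γ_n`: two Fibonacci strings are adjacent when they differ in exactly
one coordinate. -/
def fibonacciCube (n : ℕ) : SimpleGraph (fibStrings n) :=
  SimpleGraph.fromRel fun s t =>
    ∃ (u v : List Bool) (x y : Bool), x ≠ y ∧ s.1 = u ++ [x] ++ v ∧ t.1 = u ++ [y] ++ v

/-- `Θ_n(k)` (used for even `k ≥ 2`): words of length `n` over `{k/2 - 1, k/2}` in which
`k/2 - 1` does not occur twice in a row. -/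
def Theta (n k : ℕ) : Set (List ℕ) :=
  {t | t.length = n ∧ (∀ x ∈ t, x = k / 2 - 1 ∨ x = k / 2) ∧ ¬ [k / 2 - 1, k / 2 - 1] <:+: t}

/-- `Φ_n(a,b)` (used for even `n`): strings of length `n` that are words over the alphabet
`{aa, ab, ba}` in which the letter `ba` never appears (anywhere) before the letter `ab`. -/
def Phi (n a b : ℕ) : Set (List ℕ) :=
  {t | t.length = n ∧ ∃ w : List (List ℕ),
    t = w.flatten ∧ (∀ x ∈ w, x = [a, a] ∨ x = [a, b] ∨ x = [b, a]) ∧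
    w.Pairwise fun x y => ¬ (x = [b, a] ∧ y = [a, b])}

/-- `Ψ_n(a,b)` (used for odd `n`): words of length `n` over `{a, b}` that start and end with `a`,
contain no factor `bb`, and in which all runs (maximal blocks) of `a` have odd length. -/
def Psi (n a b : ℕ) : Set (List ℕ) :=
  {t | t.length = n ∧ (∀ x ∈ t, x = a ∨ x = b) ∧ t.head? = some a ∧ t.getLast? = some a ∧
    ¬ [b, b] <:+: t ∧
    ∀ (u v : List ℕ) (m : ℕ), 0 < m → t = u ++ List.replicate m a ++ v →
      u.getLast? ≠ some a → v.head? ≠ some a → Odd m}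

end KPell

/-!
Write a `k`-Pell string as a vector with two coordinates per position: the letter truncated at
`k - 1`, and a bit marking the beginning of a block `kk`. Every edge of the Pell graph changes one
coordinate by one, so the `ℓ¹` distance of the vectors bounds the distance from below
(`l1_enc_le_edist`). Conversely, a string `s` without blocks is joined to any `t` by raising and
lowering letters and then merging pairs, which costs `|x - i|` for a letter `x` opposite to a
letter `i`, and `(k - 1 - x) + (k - 1 - y) + 1` for letters `x`, `y` opposite to a block. So the
eccentricity of `s` is the sum of `max x (k - 1 - x)` over its letters, plus the best gain from
placing disjoint blocks in `t`. A block `kk` of `s` itself is never profitable: it adds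
`2 * (k - 1) + 1` to the distance from strings with two letters `0` there. By `center_eq` it is
enough to know the strings for which this eccentricity is least.

If `k = 2 * h`, each letter costs at least `h`, with equality for `h - 1` and `h`, and among these
letters a block gains a step only opposite to two letters `h - 1`. The minimum `h * n` is thus attained exactly on the
words over `{h - 1, h}` without factor `(h - 1)(h - 1)` (`exists_path_of_isThetaWord`,
`isThetaWord_or_hasFar`), which are the Fibonacci strings in other letters, with the same
adjacency.

If `k = 2 * m + 1`, a letter `x` costs `m + |x - m|`, and a block gains a step exactly opposite to
two letters that are at most `m`. Of two neighbouring letters either both are at most `m` or one is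
larger, so that every such pair costs an extra step and the minimum is `m * n + n / 2` (rounded
down). For `a = m` and `b = m + 1` the words attaining it are, for odd `n`, an `a` followed by a
word over `{aa, ba}`, and for even `n`, a word over `{aa, ab}` followed by a word over `{aa, ba}`
(`exists_path_of_excess`, `center_word_or_hasFar`). The first description amounts to all runs of
`a` being odd with no `bb` (`mem_Psi`), and both give the cardinalities by recursion on the number
of pairs.
-/

namespace KPell

/-! ### Pell strings -/

theorem IsPellString.append {k : ℕ} {s t : List ℕ} (hs : IsPellString k s)
    (ht : IsPellString k t) : IsPellString k (s ++ t) := by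
  induction hs with
  | nil => simpa
  | cons hi _ ih => exact .cons hi ih
  | double _ ih => exact .double ih

/-- A letter smaller than `k` is never half of a block `kk`, so a Pell string may be cut there. -/
theorem IsPellString.of_append_cons {k x : ℕ} (hx : x < k) {u v : List ℕ}
    (h : IsPellString k (u ++ x :: v)) : IsPellString k u ∧ IsPellString k v := by
  generalize hw : u ++ x :: v = w at h
  induction h generalizing u with
  | nil => simp at hw
  | cons hi ht ih =>
    cases u with
    | nil =>
      simp only [List.nil_append, List.cons.injEq] at hw
      exact ⟨.nil, hw.2 ▸ ht⟩
    | cons c u =>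
      simp only [List.cons_append, List.cons.injEq] at hw
      obtain ⟨h1, h2⟩ := ih hw.2
      exact ⟨.cons (hw.1 ▸ hi) h1, h2⟩
  | double ht ih =>
    match u with
    | [] =>
      simp only [List.nil_append, List.cons.injEq] at hw
      omega
    | [c] =>
      simp only [List.cons_append, List.nil_append, List.cons.injEq] at hw
      omega
    | c :: d :: u =>
      simp only [List.cons_append, List.cons.injEq] at hw
      obtain ⟨h1, h2⟩ := ih hw.2.2
      rw [hw.1, hw.2.1]
      exact ⟨.double h1, h2⟩

theorem isPellString_of_forall_lt {k : ℕ} {s : List ℕ} (h : ∀ x ∈ s, x < k) :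
    IsPellString k s := by
  induction s with
  | nil => exact .nil
  | cons x s ih =>
    simp only [List.mem_cons, forall_eq_or_imp] at h
    exact .cons h.1 (ih h.2)

/-! ### A lower bound for the distance -/

/-- Coordinates of a Pell string in a grid: every position yields two natural numbers, namely its
letter truncated at `k - 1`, followed by `1` if a block `kk` begins at the position and by `0`
otherwise. -/
def enc (k : ℕ) : List ℕ → List ℕ
  | [] => []
  | [x] => [x, 0]
  | x :: y :: t => if x = k then (k - 1) :: 1 :: (k - 1) :: 0 :: enc k t
      else x :: 0 :: enc k (y :: t)

theorem enc_cons {k x : ℕ} (hx : x < k) (t : List ℕ) : enc k (x :: t) = x :: 0 :: enc k t := by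
  cases t with
  | nil => simp [enc]
  | cons y t => simp [enc, hx.ne]

theorem enc_double (k : ℕ) (t : List ℕ) :
    enc k (k :: k :: t) = (k - 1) :: 1 :: (k - 1) :: 0 :: enc k t := by
  simp [enc]

theorem enc_append {k : ℕ} {s : List ℕ} (hs : IsPellString k s) (t : List ℕ) :
    enc k (s ++ t) = enc k s ++ enc k t := by
  induction hs with
  | nil => simp [enc]
  | cons hi _ ih => simp [enc_cons hi, ih]
  | double _ ih => simp [enc_double, ih]

theorem length_enc {k : ℕ} {s : List ℕ} (hs : IsPellString k s) :
    (enc k s).length = 2 * s.length := by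
  induction hs with
  | nil => simp [enc]
  | cons hi _ ih => simp [enc_cons hi, ih]; ring
  | double _ ih => simp [enc_double, ih]; ring

/-- The `ℓ¹` distance between two lists of natural numbers of the same length; excess entries of
the longer list are ignored. -/
def l1 : List ℕ → List ℕ → ℕ
  | x :: p, y :: q => (x - y) + (y - x) + l1 p q
  | _, _ => 0

theorem l1_self (p : List ℕ) : l1 p p = 0 := by
  induction p with
  | nil => rfl
  | cons x p ih => simp [l1, ih]

theorem l1_comm (p q : List ℕ) : l1 p q = l1 q p := by
  induction p generalizing q with
  | nil => cases q <;> rfl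
  | cons x p ih => cases q with
    | nil => rfl
    | cons y q => simp only [l1, ih q]; omega

theorem l1_append_left (p q r : List ℕ) : l1 (p ++ q) (p ++ r) = l1 q r := by
  induction p with
  | nil => rfl
  | cons x p ih => simp [l1, ih]

theorem l1_triangle {p q r : List ℕ} (h : p.length = q.length) (h' : q.length = r.length) :
    l1 p r ≤ l1 p q + l1 q r := by
  induction p generalizing q r with
  | nil => simp [l1]
  | cons x p ih =>
    match q, r with
    | y :: q, z :: r =>
      have := @ih q r (by simpa using h) (by simpa using h')
      simp only [l1]
      omega

theorem PellStep.length_eq {k : ℕ} {s t : List ℕ} (h : PellStep k s t) : s.length = t.length := by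
  rcases h with ⟨u, v, i, -, rfl, rfl⟩ | ⟨u, v, rfl, rfl⟩ <;> simp

theorem PellStep.l1_enc_le {k : ℕ} (hk : 2 ≤ k) {s t : List ℕ} (h : PellStep k s t)
    (hs : IsPellString k s) : l1 (enc k s) (enc k t) ≤ 1 := by
  rcases h with ⟨u, v, i, hi, rfl, rfl⟩ | ⟨u, v, rfl, rfl⟩
  · simp only [List.append_assoc, List.cons_append, List.nil_append] at hs ⊢
    have hu := (hs.of_append_cons (by omega)).1
    rw [enc_append hu, enc_append hu, l1_append_left, enc_cons (by omega), enc_cons (by omega)]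
    simp [l1, l1_self]
  · simp only [List.append_assoc, List.cons_append, List.nil_append] at hs ⊢
    have hu := (hs.of_append_cons (by omega)).1
    rw [enc_append hu, enc_append hu, l1_append_left, enc_cons (by omega), enc_cons (by omega),
      enc_double]
    simp [l1, l1_self]

theorem pellGraph_adj {n k : ℕ} {s t : pellStrings n k} : (pellGraph n k).Adj s t ↔
    s ≠ t ∧ (PellStep k s.1 t.1 ∨ PellStep k t.1 s.1) :=
  SimpleGraph.fromRel_adj _ _ _

theorem l1_enc_le_of_adj {n k : ℕ} (hk : 2 ≤ k) {s t : pellStrings n k}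
    (h : (pellGraph n k).Adj s t) : l1 (enc k s.1) (enc k t.1) ≤ 1 := by
  rw [pellGraph_adj] at h
  rcases h.2 with h | h
  · exact h.l1_enc_le hk s.2.1
  · rw [l1_comm]
    exact h.l1_enc_le hk t.2.1

/-- Every edge changes exactly one coordinate by one, so walks are at least as long as the `ℓ¹`
distance of the coordinates. -/
theorem l1_enc_le_edist {n k : ℕ} (hk : 2 ≤ k) (s t : pellStrings n k) :
    (l1 (enc k s.1) (enc k t.1) : ℕ∞) ≤ (pellGraph n k).edist s t := by
  refine le_iInf fun w => ?_
  rw [Nat.cast_le]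
  induction w with
  | nil => simp [l1_self]
  | @cons a b c hab w ih =>
    have h1 := l1_enc_le_of_adj hk hab
    have h2 := @l1_triangle (enc k a.1) (enc k b.1) (enc k c.1)
      (by rw [length_enc a.2.1, length_enc b.2.1, a.2.2, b.2.2])
      (by rw [length_enc b.2.1, length_enc c.2.1, b.2.2, c.2.2])
    rw [SimpleGraph.Walk.length_cons]
    omega

/-! ### Explicit paths -/

/-- `PellPath k N s t`: the string `t` is reached from `s` in `N` steps, forwards or backwards,
through `k`-Pell strings. -/
inductive PellPath (k : ℕ) : ℕ → List ℕ → List ℕ → Prop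
  | refl (s : List ℕ) : PellPath k 0 s s
  | step {N : ℕ} {s t r : List ℕ} : PellStep k s t ∨ PellStep k t s → IsPellString k t →
      PellPath k N t r → PellPath k (N + 1) s r

theorem PellStep.append {k : ℕ} {s t : List ℕ} (h : PellStep k s t) (p q : List ℕ) :
    PellStep k (p ++ s ++ q) (p ++ t ++ q) := by
  rcases h with ⟨u, v, i, hi, rfl, rfl⟩ | ⟨u, v, rfl, rfl⟩
  · exact .inl ⟨p ++ u, v ++ q, i, hi, by simp, by simp⟩
  · exact .inr ⟨p ++ u, v ++ q, by simp, by simp⟩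

theorem PellPath.append {k N : ℕ} {s t p q : List ℕ} (h : PellPath k N s t)
    (hp : IsPellString k p) (hq : IsPellString k q) :
    PellPath k N (p ++ s ++ q) (p ++ t ++ q) := by
  induction h with
  | refl s => exact .refl _
  | step h1 h2 _ ih =>
    exact .step (h1.imp (·.append p q) (·.append p q)) ((hp.append h2).append hq) ih

theorem PellPath.trans {k N M : ℕ} {s t r : List ℕ} (h : PellPath k N s t)
    (h' : PellPath k M t r) : PellPath k (N + M) s r := by
  induction h with
  | refl s => simpa
  | step h1 h2 _ ih => rw [Nat.add_right_comm]; exact .step h1 h2 (ih h')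

theorem PellPath.append_append {k N M : ℕ} {s t s' t' : List ℕ} (h : PellPath k N s t)
    (h' : PellPath k M s' t') (ht : IsPellString k t) (hs' : IsPellString k s') :
    PellPath k (N + M) (s ++ s') (t ++ t') := by
  have h1 := h.append .nil hs'
  have h2 := h'.append ht .nil
  simp only [List.nil_append, List.append_nil] at h1 h2
  exact h1.trans h2

theorem PellPath.letter_add {k i d : ℕ} (h : i + d < k) :
    PellPath k d [i] [i + d] ∧ PellPath k d [i + d] [i] := by
  induction d with
  | zero => exact ⟨.refl _, .refl _⟩
  | succ d ih =>
    have hs : PellStep k [i + d] [i + (d + 1)] := .inl ⟨[], [], i + d, by omega, rfl, rfl⟩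
    have hp : IsPellString k [i + d] := .cons (by omega) .nil
    have hp' : IsPellString k [i + (d + 1)] := .cons h .nil
    exact ⟨(ih (by omega)).1.trans (.step (.inl hs) hp' (.refl _)),
      .step (.inr hs) hp (ih (by omega)).2⟩

theorem PellPath.letter {k x y : ℕ} (hx : x < k) (hy : y < k) :
    PellPath k ((x - y) + (y - x)) [x] [y] := by
  rcases le_total x y with h | h
  · obtain ⟨d, rfl⟩ := Nat.exists_eq_add_of_le h
    convert (letter_add hy).1 using 1; omega
  · obtain ⟨d, rfl⟩ := Nat.exists_eq_add_of_le h
    convert (letter_add hx).2 using 1; omega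

theorem PellPath.cons_cons {k N x y : ℕ} {s t : List ℕ} (h : PellPath k N s t) (hx : x < k)
    (hy : y < k) (hs : IsPellString k s) :
    PellPath k ((x - y) + (y - x) + N) (x :: s) (y :: t) :=
  (letter hx hy).append_append h (.cons hy .nil) hs

/-- A block `kk` is created by raising both letters to `k - 1` and merging them. -/
theorem PellPath.cons_double {k N x y : ℕ} {s t : List ℕ} (h : PellPath k N s t) (hx : x < k)
    (hy : y < k) (hs : IsPellString k s) :
    PellPath k ((k - 1 - x) + (k - 1 - y) + 1 + N) (x :: y :: s) (k :: k :: t) := by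
  have hk : k - 1 < k := by omega
  have hd : IsPellString k [k, k] := .double .nil
  have h1 := (letter hx hk).append_append (letter hy hk) (.cons hk .nil) (.cons hy .nil)
  have h2 : PellPath k 1 [k - 1, k - 1] [k, k] :=
    .step (.inl (.inr ⟨[], [], rfl, rfl⟩)) hd (.refl _)
  have h3 := (h1.trans h2).append_append h hd hs
  have hN : (x - (k - 1) + (k - 1 - x) + (y - (k - 1) + (k - 1 - y)) + 1 + N) =
      (k - 1 - x) + (k - 1 - y) + 1 + N := by omega
  exact hN ▸ h3

theorem PellPath.edist_le {n k N : ℕ} {s t : List ℕ} (h : PellPath k N s t)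
    (hs : s ∈ pellStrings n k) (ht : t ∈ pellStrings n k) :
    (pellGraph n k).edist ⟨s, hs⟩ ⟨t, ht⟩ ≤ N := by
  induction h with
  | refl s => simp
  | @step N s t r h1 h2 _ ih =>
    have hlen : t.length = n := by
      rw [← hs.2]
      exact h1.elim (·.length_eq.symm) (·.length_eq)
    have hedge : (pellGraph n k).edist ⟨s, hs⟩ ⟨t, h2, hlen⟩ ≤ 1 := by
      rw [SimpleGraph.edist_le_one_iff_adj_or_eq, pellGraph_adj]
      by_cases hst : s = t
      · exact .inr (Subtype.ext hst)
      · exact .inl ⟨fun h => hst (congrArg Subtype.val h), h1⟩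
    refine (SimpleGraph.edist_triangle (v := ⟨t, h2, hlen⟩)).trans ?_
    rw [Nat.cast_add, Nat.cast_one, add_comm (N : ℕ∞)]
    exact add_le_add hedge (ih _ ht)

/-- A criterion for `C` to be the center: each string of `C` reaches everything within `R` steps,
while every string is `R` steps away from some other one, and more than `R` steps if it lies
outside `C`. -/
theorem center_eq {n k R : ℕ} (hk : 2 ≤ k) {C : Set (List ℕ)} (hC : C.Nonempty)
    (hsub : C ⊆ pellStrings n k)
    (hup : ∀ s ∈ C, ∀ t ∈ pellStrings n k, ∃ N ≤ R, PellPath k N s t)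
    (hlow : ∀ s ∈ pellStrings n k, ∃ t ∈ pellStrings n k,
      R ≤ l1 (enc k s) (enc k t) ∧ (s ∉ C → R < l1 (enc k s) (enc k t))) :
    Subtype.val '' (pellGraph n k).center = C := by
  have up : ∀ s : pellStrings n k, s.1 ∈ C → (pellGraph n k).eccent s ≤ R := by
    intro s hs
    rw [SimpleGraph.eccent_le_iff]
    intro t
    obtain ⟨N, hN, hp⟩ := hup s.1 hs t.1 t.2
    exact (hp.edist_le s.2 t.2).trans (Nat.cast_le.2 hN)
  have low : ∀ s : pellStrings n k, (R : ℕ∞) ≤ (pellGraph n k).eccent s := by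
    intro s
    obtain ⟨t, ht, h, -⟩ := hlow s.1 s.2
    exact (Nat.cast_le.2 h).trans
      ((l1_enc_le_edist hk s ⟨t, ht⟩).trans SimpleGraph.edist_le_eccent)
  have low' : ∀ s : pellStrings n k, s.1 ∉ C → (R : ℕ∞) < (pellGraph n k).eccent s := by
    intro s hs
    obtain ⟨t, ht, -, h⟩ := hlow s.1 s.2
    exact (Nat.cast_lt.2 (h hs)).trans_le
      ((l1_enc_le_edist hk s ⟨t, ht⟩).trans SimpleGraph.edist_le_eccent)
  have hR : (pellGraph n k).radius = R := by
    obtain ⟨c, hc⟩ := hC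
    exact le_antisymm ((iInf_le _ ⟨c, hsub hc⟩).trans (up ⟨c, hsub hc⟩ hc)) (le_iInf low)
  ext s
  constructor
  · rintro ⟨s, hs, rfl⟩
    by_contra h
    have h1 := low' s h
    have h2 : (pellGraph n k).eccent s = (pellGraph n k).radius := hs
    rw [h2, hR] at h1
    exact lt_irrefl _ h1
  · intro hs
    refine ⟨⟨s, hsub hs⟩, ?_, rfl⟩
    change (pellGraph n k).eccent _ = (pellGraph n k).radius
    rw [hR]
    exact le_antisymm (up _ hs) (low _)

/-! ### Far strings -/

/-- Some `k`-Pell string of the same length has `ℓ¹` distance at least `D` from `s`. -/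
def HasFar (k : ℕ) (s : List ℕ) (D : ℕ) : Prop :=
  ∃ t, IsPellString k t ∧ t.length = s.length ∧ D ≤ l1 (enc k s) (enc k t)

theorem HasFar.mono {k D E : ℕ} {s : List ℕ} (h : HasFar k s D) (hE : E ≤ D) : HasFar k s E := by
  obtain ⟨t, h1, h2, h3⟩ := h
  exact ⟨t, h1, h2, hE.trans h3⟩

theorem HasFar.nil (k : ℕ) : HasFar k [] 0 := ⟨[], .nil, rfl, Nat.zero_le _⟩

theorem HasFar.cons {k x D : ℕ} {s : List ℕ} (hx : x < k) (h : HasFar k s D) :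
    HasFar k (x :: s) (max x (k - 1 - x) + D) := by
  obtain ⟨t, h1, h2, h3⟩ := h
  rcases le_total x (k - 1 - x) with hle | hle
  · refine ⟨(k - 1) :: t, .cons (by omega) h1, by simp [h2], ?_⟩
    rw [enc_cons hx, enc_cons (by omega)]
    simp only [l1]
    omega
  · refine ⟨0 :: t, .cons (by omega) h1, by simp [h2], ?_⟩
    rw [enc_cons hx, enc_cons (by omega)]
    simp only [l1]
    omega

/-- A block `kk` of the far string opposite to two letters. -/
theorem HasFar.cons_cons {k x y D : ℕ} {s : List ℕ} (hx : x < k) (hy : y < k)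
    (h : HasFar k s D) : HasFar k (x :: y :: s) ((k - 1 - x) + (k - 1 - y) + 1 + D) := by
  obtain ⟨t, h1, h2, h3⟩ := h
  refine ⟨k :: k :: t, .double h1, by simp [h2], ?_⟩
  rw [enc_cons hx, enc_cons hy, enc_double]
  simp only [l1]
  omega

theorem HasFar.double {k D : ℕ} {s : List ℕ} (hk : 0 < k) (h : HasFar k s D) :
    HasFar k (k :: k :: s) (2 * (k - 1) + 1 + D) := by
  obtain ⟨t, h1, h2, h3⟩ := h
  refine ⟨0 :: 0 :: t, .cons hk (.cons hk h1), by simp [h2], ?_⟩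
  rw [enc_cons hk, enc_cons hk, enc_double]
  simp only [l1]
  omega

/-! ### The center for even `k` -/

/-- Words over `{h - 1, h}` without two consecutive letters `h - 1`. -/
def IsThetaWord (h : ℕ) (s : List ℕ) : Prop :=
  (∀ x ∈ s, x = h - 1 ∨ x = h) ∧ ¬ [h - 1, h - 1] <:+: s

theorem isThetaWord_nil (h : ℕ) : IsThetaWord h [] := by simp [IsThetaWord]

theorem IsThetaWord.tail {h x : ℕ} {s : List ℕ} (hs : IsThetaWord h (x :: s)) :
    IsThetaWord h s :=
  ⟨fun y hy => hs.1 y (List.mem_cons_of_mem _ hy), fun hi => hs.2 (List.infix_cons hi)⟩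

theorem IsThetaWord.head {h x : ℕ} {s : List ℕ} (hs : IsThetaWord h (x :: s)) :
    x = h - 1 ∨ x = h := hs.1 x List.mem_cons_self

theorem IsThetaWord.head_ne {h x y : ℕ} {s : List ℕ} (hs : IsThetaWord h (x :: y :: s)) :
    ¬ (x = h - 1 ∧ y = h - 1) := by
  rintro ⟨rfl, rfl⟩
  exact hs.2 ⟨[], s, rfl⟩

theorem isThetaWord_cons {h x : ℕ} {s : List ℕ} (hx : x = h - 1 ∨ x = h)
    (hxs : ∀ r, s = (h - 1) :: r → x ≠ h - 1) (hs : IsThetaWord h s) :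
    IsThetaWord h (x :: s) := by
  refine ⟨by simpa using ⟨hx, hs.1⟩, fun hi => ?_⟩
  rcases List.infix_cons_iff.1 hi with ⟨r, hr⟩ | hi
  · simp only [List.cons_append, List.nil_append, List.cons.injEq] at hr
    exact hxs r hr.2.symm hr.1.symm
  · exact hs.2 hi

theorem exists_path_of_isThetaWord {h : ℕ} (hh : 1 ≤ h) {s t : List ℕ} (hs : IsThetaWord h s)
    (ht : IsPellString (2 * h) t) (hl : s.length = t.length) :
    ∃ N ≤ h * t.length, PellPath (2 * h) N s t := by
  have hp : ∀ {s : List ℕ}, IsThetaWord h s → IsPellString (2 * h) s := fun hs =>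
    isPellString_of_forall_lt fun x hx => by have := hs.1 x hx; omega
  induction ht generalizing s with
  | nil => exact ⟨0, by simp, by rw [List.length_eq_zero_iff.1 hl]; exact .refl _⟩
  | @cons i t hi ht ih =>
    match s with
    | x :: s =>
      obtain ⟨N, hN, hpath⟩ := ih hs.tail (by simpa using hl)
      have hx := hs.head
      refine ⟨_, ?_, hpath.cons_cons (by omega) hi (hp hs.tail)⟩
      simp only [List.length_cons, mul_add, mul_one]
      omega
  | @double t ht ih =>
    match s with
    | x :: y :: s =>
      obtain ⟨N, hN, hpath⟩ := ih hs.tail.tail (by simpa using hl)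
      have hx := hs.head
      have hy := hs.tail.head
      have hxy := hs.head_ne
      refine ⟨_, ?_, hpath.cons_double (by omega) (by omega) (hp hs.tail.tail)⟩
      simp only [List.length_cons, mul_add, mul_one]
      omega

theorem hasFar_half {h : ℕ} (hh : 1 ≤ h) {s : List ℕ} (hs : IsPellString (2 * h) s) :
    HasFar (2 * h) s (h * s.length) := by
  induction hs with
  | nil => exact .nil _
  | cons hi _ ih =>
    refine (ih.cons hi).mono ?_
    simp only [List.length_cons, mul_add, mul_one]
    omega
  | double _ ih =>
    refine (ih.double (by omega)).mono ?_
    simp only [List.length_cons, mul_add, mul_one]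
    omega

/-- Outside the words of `IsThetaWord`, either a letter off the middle or a block `kk` opposite
to two letters `h - 1` gains one more step. -/
theorem isThetaWord_or_hasFar {h : ℕ} (hh : 1 ≤ h) {s : List ℕ}
    (hs : IsPellString (2 * h) s) : IsThetaWord h s ∨ HasFar (2 * h) s (h * s.length + 1) := by
  induction hs with
  | nil => exact .inl (isThetaWord_nil h)
  | @cons i s hi hs ih =>
    rcases ih with ih | ih
    · by_cases hx : i = h - 1 ∨ i = h
      · by_cases hr : ∃ r, s = (h - 1) :: r ∧ i = h - 1
        · obtain ⟨r, rfl, rfl⟩ := hr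
          right
          have hr := (hs.of_append_cons (u := []) (by omega)).2
          refine ((hasFar_half hh hr).cons_cons hi hi).mono ?_
          simp only [List.length_cons, mul_add, mul_one]
          omega
        · exact .inl (isThetaWord_cons hx (fun r h1 h2 => hr ⟨r, h1, h2⟩) ih)
      · right
        refine ((hasFar_half hh hs).cons hi).mono ?_
        simp only [List.length_cons, mul_add, mul_one]
        omega
    · right
      refine (ih.cons hi).mono ?_
      simp only [List.length_cons, mul_add, mul_one]
      omega
  | @double s hs ih =>
    right
    refine ((hasFar_half hh hs).double (by omega)).mono ?_
    simp only [List.length_cons, mul_add, mul_one]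
    omega

theorem mem_Theta_two_mul {n h : ℕ} {s : List ℕ} :
    s ∈ Theta n (2 * h) ↔ s.length = n ∧ IsThetaWord h s := by
  simp [Theta, IsThetaWord]

theorem center_eq_Theta {n h : ℕ} (hh : 1 ≤ h) :
    Subtype.val '' (pellGraph n (2 * h)).center = Theta n (2 * h) := by
  refine center_eq (R := h * n) (by omega) ⟨List.replicate n h, ?_⟩ ?_ ?_ ?_
  · rw [mem_Theta_two_mul]
    refine ⟨by simp, fun x hx => .inr (List.eq_of_mem_replicate hx), fun hi => ?_⟩
    have := List.eq_of_mem_replicate (hi.subset (List.mem_cons_self (a := h - 1)))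
    omega
  · intro s hs
    rw [mem_Theta_two_mul] at hs
    exact ⟨isPellString_of_forall_lt fun x hx => by have := hs.2.1 x hx; omega, hs.1⟩
  · intro s hs t ht
    rw [mem_Theta_two_mul] at hs
    rw [← ht.2]
    exact exists_path_of_isThetaWord hh hs.2 ht.1 (hs.1.trans ht.2.symm)
  · rintro s ⟨hs, rfl⟩
    rcases isThetaWord_or_hasFar hh hs with h1 | ⟨t, h1, h2, h3⟩
    · obtain ⟨t, h2, h3, h4⟩ := hasFar_half hh hs
      exact ⟨t, ⟨h2, h3⟩, h4, fun hn => (hn (mem_Theta_two_mul.2 ⟨rfl, h1⟩)).elim⟩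
    · exact ⟨t, ⟨h1, h2⟩, by omega, fun _ => by omega⟩

/-! ### The Fibonacci cube -/

theorem fibStrings_zero : fibStrings 0 = {[]} := by
  ext w
  simp only [fibStrings, Set.mem_ofPred_eq, List.length_eq_zero_iff, Set.mem_singleton_iff]
  constructor
  · exact And.left
  · rintro rfl; simp

theorem fibStrings_one : fibStrings 1 = {[false], [true]} := by
  ext w
  simp only [fibStrings, Set.mem_ofPred_eq, List.length_eq_one_iff, Set.mem_insert_iff,
    Set.mem_singleton_iff]
  constructor
  · rintro ⟨⟨a, rfl⟩, -⟩; cases a <;> simp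
  · rintro (rfl | rfl) <;> simp [List.infix_cons_iff]

theorem fibStrings_add_two (n : ℕ) : fibStrings (n + 2) =
    (List.cons false) '' fibStrings (n + 1) ∪ (fun w => true :: false :: w) '' fibStrings n := by
  ext w
  match w with
  | [] => simp [fibStrings]
  | [x] => cases x <;> simp [fibStrings]
  | true :: true :: w => simp [fibStrings, List.infix_cons_iff]
  | true :: false :: w => simp [fibStrings, List.infix_cons_iff]
  | false :: y :: w => simp [fibStrings, List.infix_cons_iff]

theorem ncard_fibStrings (n : ℕ) :
    (fibStrings n).Finite ∧ (fibStrings n).ncard = Nat.fib (n + 2) := by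
  induction n using Nat.twoStepInduction with
  | zero => simp [fibStrings_zero]
  | one =>
    rw [fibStrings_one]
    exact ⟨Set.toFinite _, Set.ncard_pair (by simp)⟩
  | more n h0 h1 =>
    rw [fibStrings_add_two]
    refine ⟨(h1.1.image _).union (h0.1.image _), ?_⟩
    rw [Set.ncard_union_eq _ (h1.1.image _) (h0.1.image _),
      Set.ncard_image_of_injective _ List.cons_injective, Set.ncard_image_of_injective, h0.2, h1.2,
      Nat.fib_add_two (n := n + 2), add_comm]
    · intro u v h; simpa using h
    · rw [Set.disjoint_left]
      rintro _ ⟨u, -, rfl⟩ ⟨v, -, h⟩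
      simp at h

/-- The bit of a letter of a word over `{h - 1, h}`; the letter `h - 1` becomes `true`. -/
def toBit (h x : ℕ) : Bool := x == h - 1

/-- The inverse of `toBit`. -/
def ofBit (h : ℕ) (b : Bool) : ℕ := if b then h - 1 else h

theorem toBit_ofBit {h : ℕ} (hh : 1 ≤ h) (b : Bool) : toBit h (ofBit h b) = b := by
  cases b <;> simp [toBit, ofBit]; omega

theorem ofBit_toBit {h x : ℕ} (hx : x = h - 1 ∨ x = h) : ofBit h (toBit h x) = x := by
  by_cases h1 : x = h - 1
  · simp [toBit, ofBit, h1]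
  · simp [toBit, ofBit, hx.resolve_left h1]
    omega

theorem map_ofBit_map_toBit {h : ℕ} {s : List ℕ} (hs : IsThetaWord h s) :
    (s.map (toBit h)).map (ofBit h) = s := by
  rw [List.map_map]
  conv_rhs => rw [← List.map_id s]
  exact List.map_congr_left fun x hx => ofBit_toBit (hs.1 x hx)

theorem map_toBit_map_ofBit {h : ℕ} (hh : 1 ≤ h) (w : List Bool) :
    (w.map (ofBit h)).map (toBit h) = w := by
  rw [List.map_map]
  conv_rhs => rw [← List.map_id w]
  exact List.map_congr_left fun x _ => toBit_ofBit hh x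

/-- Words over `{h - 1, h}` without two consecutive `h - 1` are the Fibonacci strings, in the
letters `h - 1` and `h` instead of `1` and `0`. -/
def thetaEquiv {n h : ℕ} (hh : 1 ≤ h) : Theta n (2 * h) ≃ fibStrings n where
  toFun s := ⟨s.1.map (toBit h), by
    obtain ⟨h1, h2⟩ := mem_Theta_two_mul.1 s.2
    refine ⟨by simpa using h1, fun hi => h2.2 ?_⟩
    have := hi.map (ofBit h)
    rwa [map_ofBit_map_toBit h2] at this⟩
  invFun w := ⟨w.1.map (ofBit h), by
    rw [mem_Theta_two_mul]
    refine ⟨by simpa using w.2.1, ?_, fun hi => w.2.2 ?_⟩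
    · simp only [List.mem_map, forall_exists_index, and_imp]
      rintro _ b - rfl
      cases b <;> simp [ofBit]
    · have := hi.map (toBit h)
      rw [map_toBit_map_ofBit hh] at this
      simpa [toBit] using this⟩
  left_inv s := Subtype.ext (map_ofBit_map_toBit (mem_Theta_two_mul.1 s.2).2)
  right_inv w := Subtype.ext (map_toBit_map_ofBit hh w.1)

theorem ncard_Theta {n h : ℕ} (hh : 1 ≤ h) : (Theta n (2 * h)).ncard = Nat.fib (n + 2) := by
  rw [← (ncard_fibStrings n).2]
  exact Set.ncard_congr' (thetaEquiv hh)

/-- Between words over `{h - 1, h}` the steps of the Pell graph are the changes of one letter. -/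
theorem pellStep_iff_of_isThetaWord {h : ℕ} (hh : 1 ≤ h) {s t : List ℕ} (hs : IsThetaWord h s)
    (ht : IsThetaWord h t) : PellStep (2 * h) s t ↔ ∃ u v : List Bool,
      s.map (toBit h) = u ++ [true] ++ v ∧ t.map (toBit h) = u ++ [false] ++ v := by
  constructor
  · rintro (⟨u, v, i, -, rfl, rfl⟩ | ⟨u, v, rfl, rfl⟩)
    · have h1 := hs.1 i (by simp)
      have h2 := ht.1 (i + 1) (by simp)
      refine ⟨u.map (toBit h), v.map (toBit h), ?_, ?_⟩
      · simp [toBit]; omega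
      · simp [toBit]; omega
    · have := ht.1 (2 * h) (by simp)
      omega
  · rintro ⟨u, v, h1, h2⟩
    refine .inl ⟨u.map (ofBit h), v.map (ofBit h), h - 1, by omega, ?_, ?_⟩
    · rw [← map_ofBit_map_toBit hs, h1]
      simp [ofBit]
    · rw [← map_ofBit_map_toBit ht, h2]
      simp [ofBit]
      omega

theorem nonempty_iso_fibonacciCube {n h : ℕ} (hh : 1 ≤ h) :
    Nonempty ((pellGraph n (2 * h)).induce (pellGraph n (2 * h)).center ≃g fibonacciCube n) := by
  have hC := center_eq_Theta (n := n) hh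
  let e₁ : (pellGraph n (2 * h)).center ≃ Theta n (2 * h) :=
    (Equiv.Set.image _ _ Subtype.val_injective).trans (Equiv.setCongr hC)
  refine ⟨⟨e₁.trans (thetaEquiv hh), ?_⟩⟩
  intro s t
  have hs : IsThetaWord h s.1.1 := (mem_Theta_two_mul.1 (e₁ s).2).2
  have ht : IsThetaWord h t.1.1 := (mem_Theta_two_mul.1 (e₁ t).2).2
  have hs' : ((e₁.trans (thetaEquiv hh)) s).1 = s.1.1.map (toBit h) := rfl
  have ht' : ((e₁.trans (thetaEquiv hh)) t).1 = t.1.1.map (toBit h) := rfl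
  rw [fibonacciCube, SimpleGraph.induce, SimpleGraph.comap_adj, pellGraph_adj,
    SimpleGraph.fromRel_adj, hs', ht', (Equiv.injective _).ne_iff]
  refine and_congr ⟨fun h1 h2 => h1 (Subtype.ext h2), fun h1 h2 => h1 (congrArg _ h2)⟩ ?_
  simp only [Function.Embedding.subtype_apply]
  rw [pellStep_iff_of_isThetaWord hh hs ht, pellStep_iff_of_isThetaWord hh ht hs]
  constructor
  · rintro (⟨u, v, x, y, hxy, h1, h2⟩ | ⟨u, v, x, y, hxy, h1, h2⟩) <;>
      cases x <;> cases y <;> simp only [ne_eq, not_true_eq_false] at hxy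
    · exact .inr ⟨u, v, h2, h1⟩
    · exact .inl ⟨u, v, h1, h2⟩
    · exact .inl ⟨u, v, h2, h1⟩
    · exact .inr ⟨u, v, h1, h2⟩
  · rintro (⟨u, v, h1, h2⟩ | ⟨u, v, h1, h2⟩)
    · exact .inl ⟨u, v, _, _, by simp, h1, h2⟩
    · exact .inr ⟨u, v, _, _, by simp, h1, h2⟩

/-! ### Words describing the center for odd `k` -/

/-- Words over `{aa, ba}`. -/
inductive IsTailWord (a b : ℕ) : List ℕ → Prop
  | nil : IsTailWord a b []
  | aa {s : List ℕ} : IsTailWord a b s → IsTailWord a b (a :: a :: s)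
  | ba {s : List ℕ} : IsTailWord a b s → IsTailWord a b (b :: a :: s)

/-- Words over `{aa, ab, ba}` without `ba` before `ab`: a word over `{aa, ab}` followed by a word
over `{aa, ba}`. -/
inductive IsPhiWord (a b : ℕ) : List ℕ → Prop
  | tail {s : List ℕ} : IsTailWord a b s → IsPhiWord a b s
  | aa {s : List ℕ} : IsPhiWord a b s → IsPhiWord a b (a :: a :: s)
  | ab {s : List ℕ} : IsPhiWord a b s → IsPhiWord a b (a :: b :: s)

theorem IsTailWord.mem {a b : ℕ} {s : List ℕ} (hs : IsTailWord a b s) :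
    ∀ x ∈ s, x = a ∨ x = b := by
  induction hs with
  | nil => simp
  | aa _ ih => simpa using ih
  | ba _ ih => simpa using ih

theorem IsPhiWord.mem {a b : ℕ} {s : List ℕ} (hs : IsPhiWord a b s) :
    ∀ x ∈ s, x = a ∨ x = b := by
  induction hs with
  | tail h => exact h.mem
  | aa _ ih => simpa using ih
  | ab _ ih => simpa using ih

theorem isPhiWord_flatten_iff {a b : ℕ} (hab : a ≠ b) {s : List ℕ} :
    IsPhiWord a b s ↔ ∃ w : List (List ℕ), s = w.flatten ∧
      (∀ x ∈ w, x = [a, a] ∨ x = [a, b] ∨ x = [b, a]) ∧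
      w.Pairwise fun x y => ¬ (x = [b, a] ∧ y = [a, b]) := by
  constructor
  · intro h
    have htail : ∀ {s}, IsTailWord a b s → ∃ w : List (List ℕ), s = w.flatten ∧
        ∀ x ∈ w, x = [a, a] ∨ x = [b, a] := by
      intro s h
      induction h with
      | nil => exact ⟨[], by simp⟩
      | aa _ ih =>
        obtain ⟨w, rfl, hw⟩ := ih
        exact ⟨[a, a] :: w, by simp, by simpa using hw⟩
      | ba _ ih =>
        obtain ⟨w, rfl, hw⟩ := ih
        exact ⟨[b, a] :: w, by simp, by simpa using hw⟩
    induction h with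
    | tail h =>
      obtain ⟨w, rfl, hw⟩ := htail h
      refine ⟨w, rfl, fun x hx => (hw x hx).imp_right .inr, ?_⟩
      refine List.pairwise_of_forall_mem_list fun x _ y hy hxy => ?_
      rcases hw y hy with h | h <;> simp [hxy.2, hab, hab.symm] at h
    | aa _ ih =>
      obtain ⟨w, rfl, hw, hp⟩ := ih
      exact ⟨[a, a] :: w, by simp, by simpa using hw, by simpa [hab] using hp⟩
    | ab _ ih =>
      obtain ⟨w, rfl, hw, hp⟩ := ih
      exact ⟨[a, b] :: w, by simp, by simpa using hw, by simpa [hab] using hp⟩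
  · rintro ⟨w, rfl, hw, hp⟩
    have htail : ∀ w : List (List ℕ), (∀ x ∈ w, x = [a, a] ∨ x = [b, a]) →
        IsTailWord a b w.flatten := by
      intro w hw
      induction w with
      | nil => exact .nil
      | cons x w ih =>
        simp only [List.mem_cons, forall_eq_or_imp] at hw
        rcases hw.1 with rfl | rfl
        · exact .aa (ih hw.2)
        · exact .ba (ih hw.2)
    induction w with
    | nil => exact .tail .nil
    | cons x w ih =>
      simp only [List.mem_cons, forall_eq_or_imp] at hw
      rw [List.pairwise_cons] at hp
      rcases hw.1 with rfl | rfl | rfl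
      · exact .aa (ih hw.2 hp.2)
      · exact .ab (ih hw.2 hp.2)
      · refine .tail (.ba (htail w fun y hy => ?_))
        rcases hw.2 y hy with h | h | h
        · exact .inl h
        · exact (hp.1 y hy ⟨rfl, h⟩).elim
        · exact .inr h

theorem mem_Phi {n a b : ℕ} (hab : a ≠ b) {s : List ℕ} :
    s ∈ Phi n a b ↔ s.length = n ∧ IsPhiWord a b s := by
  rw [isPhiWord_flatten_iff hab]
  rfl

/-- The conditions on the letters, the ends and the runs in the definition of `Psi`, for words of
arbitrary length. -/
def IsPsiWord (a b : ℕ) (t : List ℕ) : Prop :=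
  (∀ x ∈ t, x = a ∨ x = b) ∧ t.head? = some a ∧ t.getLast? = some a ∧
    ¬ [b, b] <:+: t ∧
    ∀ (u v : List ℕ) (m : ℕ), 0 < m → t = u ++ List.replicate m a ++ v →
      u.getLast? ≠ some a → v.head? ≠ some a → Odd m

theorem IsTailWord.isPsiWord {a b : ℕ} (hab : a ≠ b) {s : List ℕ} (hs : IsTailWord a b s) :
    IsPsiWord a b (a :: s) := by
  refine ⟨by simpa using hs.mem, rfl, ?_, ?_, ?_⟩
  · induction hs with
    | nil => rfl
    | aa _ ih => simpa using ih
    | ba _ ih => simpa using ih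
  · induction hs with
    | nil => simp [List.infix_cons_iff]
    | aa _ ih =>
      rw [List.infix_cons_iff, List.infix_cons_iff]
      simp [hab.symm, ih]
    | ba _ ih =>
      rw [List.infix_cons_iff, List.infix_cons_iff]
      simp [hab.symm, ih]
  · induction hs with
    | nil =>
      intro u v m hm h hu hv
      have hl := congrArg List.length h
      simp only [List.length_append, List.length_replicate, List.length_cons,
        List.length_nil] at hl
      have : m = 1 := by omega
      simp [this]
    | @aa s hs ih =>
      intro u v m hm h hu hv
      match u with
      | [] =>
        match m with
        | 1 =>
          simp only [List.replicate_one, List.nil_append, List.cons_append,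
            List.cons.injEq, true_and] at h
          simp [← h] at hv
        | 2 =>
          simp [List.replicate_succ] at h
          simp [← h] at hv
        | m + 3 =>
          have := ih [] v (m + 1) (by omega) (by simpa [List.replicate_succ] using h) hu hv
          simpa [parity_simps] using this
      | [c] =>
        simp only [List.cons_append, List.cons.injEq] at h
        simp [← h.1] at hu
      | c :: [d] =>
        simp only [List.cons_append, List.cons.injEq] at h
        simp [← h.2.1] at hu
      | c :: d :: e :: u =>
        simp only [List.cons_append, List.cons.injEq] at h
        exact ih (e :: u) v m hm (by simpa using h.2.2) (by simpa using hu) hv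
    | @ba s hs ih =>
      intro u v m hm h hu hv
      match u with
      | [] =>
        match m with
        | 1 => exact odd_one
        | m + 2 =>
          simp [List.replicate_succ, hab.symm] at h
      | [c] =>
        simp only [List.cons_append, List.cons.injEq] at h
        simp [← h.1] at hu
      | c :: [d] =>
        simp only [List.cons_append, List.nil_append, List.cons.injEq] at h
        exact ih [] v m hm (by simpa using h.2.2) (by simp) hv
      | c :: d :: e :: u =>
        simp only [List.cons_append, List.cons.injEq] at h
        exact ih (e :: u) v m hm (by simpa using h.2.2) (by simpa using hu) hv

theorem IsPsiWord.exists_isTailWord {a b : ℕ} (hab : a ≠ b) :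
    ∀ {t : List ℕ}, IsPsiWord a b t → ∃ s, t = a :: s ∧ IsTailWord a b s
  | [], h => by simp [IsPsiWord] at h
  | [c], h => by
    obtain ⟨-, h2, -⟩ := h
    simp only [List.head?_cons, Option.some.injEq] at h2
    exact ⟨[], by rw [h2], .nil⟩
  | [c, d], h => by
    obtain ⟨-, h2, h3, -, h5⟩ := h
    simp only [List.head?_cons, Option.some.injEq] at h2
    simp only [List.getLast?_cons_cons, List.getLast?_singleton, Option.some.injEq] at h3
    subst h2 h3
    exact absurd (h5 [] [] 2 (by omega) rfl (by simp) (by simp)) (by decide)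
  | c :: d :: e :: r, h => by
    obtain ⟨h1, h2, h3, h4, h5⟩ := h
    simp only [List.head?_cons, Option.some.injEq] at h2
    subst h2
    have hd := h1 d (by simp)
    have he := h1 e (by simp)
    -- the letter after `cc` or `cb` is `c`: the first run is not of length two, and `bb` is barred
    have hec : e = c := by
      refine he.resolve_right fun he => ?_
      subst he
      rcases hd with rfl | rfl
      · exact absurd (h5 [] (e :: r) 2 (by omega) rfl (by simp) (by simpa using hab.symm))
          (by decide)
      · exact h4 ⟨[c], r, rfl⟩
    subst hec
    have hrec : IsPsiWord e b (e :: r) := by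
      refine ⟨fun x hx => h1 x (by simp at hx ⊢; tauto), rfl, by simpa using h3,
        fun hi => h4 (List.infix_cons (List.infix_cons hi)), ?_⟩
      intro u v m hm h hu hv
      match u with
      | [] =>
        rcases hd with rfl | rfl
        · have := h5 [] v (m + 2) (by omega) (by simpa [List.replicate_succ] using h) hu hv
          simpa [parity_simps] using this
        · exact h5 [e, d] v m hm (by simpa using h) (by simpa using hab.symm) hv
      | x :: u =>
        exact h5 (e :: d :: x :: u) v m hm (by simpa using h) (by simpa using hu) hv
    obtain ⟨s, hs, hs'⟩ := hrec.exists_isTailWord hab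
    simp only [List.cons.injEq, true_and] at hs
    subst hs
    rcases hd with rfl | rfl
    · exact ⟨_, rfl, hs'.aa⟩
    · exact ⟨_, rfl, hs'.ba⟩

theorem mem_Psi {n a b : ℕ} (hab : a ≠ b) {t : List ℕ} :
    t ∈ Psi n a b ↔ t.length = n ∧ ∃ s, t = a :: s ∧ IsTailWord a b s := by
  have h : t ∈ Psi n a b ↔ t.length = n ∧ IsPsiWord a b t := Iff.rfl
  rw [h]
  refine and_congr_right fun _ => ⟨fun h => h.exists_isTailWord hab, ?_⟩
  rintro ⟨s, rfl, hs⟩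
  exact hs.isPsiWord hab

/-! ### Counting -/

theorem setOf_isTailWord_add_one (a b p : ℕ) :
    {s | s.length = 2 * (p + 1) ∧ IsTailWord a b s} =
      (fun s => a :: a :: s) '' {s | s.length = 2 * p ∧ IsTailWord a b s} ∪
      (fun s => b :: a :: s) '' {s | s.length = 2 * p ∧ IsTailWord a b s} := by
  ext s
  constructor
  · rintro ⟨hl, hs⟩
    cases hs with
    | nil => simp at hl
    | aa hs => exact .inl ⟨_, ⟨by simp at hl; omega, hs⟩, rfl⟩
    | ba hs => exact .inr ⟨_, ⟨by simp at hl; omega, hs⟩, rfl⟩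
  · rintro (⟨s, ⟨hl, hs⟩, rfl⟩ | ⟨s, ⟨hl, hs⟩, rfl⟩)
    · exact ⟨by simp [hl]; omega, hs.aa⟩
    · exact ⟨by simp [hl]; omega, hs.ba⟩

theorem setOf_isPhiWord_add_one (a b p : ℕ) :
    {s | s.length = 2 * (p + 1) ∧ IsPhiWord a b s} =
      ((fun s => a :: a :: s) '' {s | s.length = 2 * p ∧ IsPhiWord a b s} ∪
      (fun s => a :: b :: s) '' {s | s.length = 2 * p ∧ IsPhiWord a b s}) ∪
      (fun s => b :: a :: s) '' {s | s.length = 2 * p ∧ IsTailWord a b s} := by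
  ext s
  constructor
  · rintro ⟨hl, hs⟩
    cases hs with
    | tail hs =>
      cases hs with
      | nil => simp at hl
      | aa hs => exact .inl (.inl ⟨_, ⟨by simp at hl; omega, .tail hs⟩, rfl⟩)
      | ba hs => exact .inr ⟨_, ⟨by simp at hl; omega, hs⟩, rfl⟩
    | aa hs => exact .inl (.inl ⟨_, ⟨by simp at hl; omega, hs⟩, rfl⟩)
    | ab hs => exact .inl (.inr ⟨_, ⟨by simp at hl; omega, hs⟩, rfl⟩)
  · rintro ((⟨s, ⟨hl, hs⟩, rfl⟩ | ⟨s, ⟨hl, hs⟩, rfl⟩) | ⟨s, ⟨hl, hs⟩, rfl⟩)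
    · exact ⟨by simp [hl]; omega, hs.aa⟩
    · exact ⟨by simp [hl]; omega, hs.ab⟩
    · exact ⟨by simp [hl]; omega, .tail hs.ba⟩

theorem cons_cons_injective (a b : ℕ) : Function.Injective fun s : List ℕ => a :: b :: s := by
  intro s t h
  simpa using h

theorem disjoint_image_cons_cons {a b c d : ℕ} (h : ¬ (a = c ∧ b = d)) (S T : Set (List ℕ)) :
    Disjoint ((fun s => a :: b :: s) '' S) ((fun s => c :: d :: s) '' T) := by
  rw [Set.disjoint_left]
  rintro _ ⟨s, -, rfl⟩ ⟨t, -, ht⟩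
  simp only [List.cons.injEq] at ht
  exact h ⟨ht.1.symm, ht.2.1.symm⟩

theorem ncard_isTailWord {a b : ℕ} (hab : a ≠ b) (p : ℕ) :
    {s | s.length = 2 * p ∧ IsTailWord a b s}.Finite ∧
      {s | s.length = 2 * p ∧ IsTailWord a b s}.ncard = 2 ^ p := by
  induction p with
  | zero =>
    have : {s | s.length = 2 * 0 ∧ IsTailWord a b s} = {[]} := by
      ext s
      simp only [mul_zero, List.length_eq_zero_iff, Set.mem_ofPred_eq, Set.mem_singleton_iff]
      exact ⟨And.left, fun h => ⟨h, h ▸ .nil⟩⟩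
    rw [this]
    simp
  | succ p ih =>
    rw [setOf_isTailWord_add_one]
    refine ⟨(ih.1.image _).union (ih.1.image _), ?_⟩
    rw [Set.ncard_union_eq (disjoint_image_cons_cons (by tauto) _ _) (ih.1.image _)
      (ih.1.image _), Set.ncard_image_of_injective _ (cons_cons_injective _ _),
      Set.ncard_image_of_injective _ (cons_cons_injective _ _), ih.2]
    ring

theorem ncard_isPhiWord {a b : ℕ} (hab : a ≠ b) (p : ℕ) :
    {s | s.length = 2 * p ∧ IsPhiWord a b s}.Finite ∧
      2 * {s | s.length = 2 * p ∧ IsPhiWord a b s}.ncard = (p + 2) * 2 ^ p := by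
  induction p with
  | zero =>
    have : {s | s.length = 2 * 0 ∧ IsPhiWord a b s} = {[]} := by
      ext s
      simp only [mul_zero, List.length_eq_zero_iff, Set.mem_ofPred_eq, Set.mem_singleton_iff]
      exact ⟨And.left, fun h => ⟨h, h ▸ .tail .nil⟩⟩
    rw [this]
    simp
  | succ p ih =>
    have ht := ncard_isTailWord hab p
    rw [setOf_isPhiWord_add_one]
    refine ⟨((ih.1.image _).union (ih.1.image _)).union (ht.1.image _), ?_⟩
    rw [Set.ncard_union_eq _ ((ih.1.image _).union (ih.1.image _)) (ht.1.image _),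
      Set.ncard_union_eq (disjoint_image_cons_cons (by tauto) _ _) (ih.1.image _)
      (ih.1.image _), Set.ncard_image_of_injective _ (cons_cons_injective _ _),
      Set.ncard_image_of_injective _ (cons_cons_injective _ _),
      Set.ncard_image_of_injective _ (cons_cons_injective _ _), ht.2]
    · rw [mul_add, mul_add, ih.2]
      ring
    · exact Set.disjoint_union_left.2 ⟨disjoint_image_cons_cons (by tauto) _ _,
        disjoint_image_cons_cons (by tauto) _ _⟩

theorem ncard_Phi {a b : ℕ} (hab : a ≠ b) (p : ℕ) :
    2 * (Phi (2 * p) a b).ncard = (p + 2) * 2 ^ p := by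
  rw [← (ncard_isPhiWord hab p).2]
  congr 2
  ext s
  exact mem_Phi hab

theorem ncard_Psi {a b : ℕ} (hab : a ≠ b) (p : ℕ) : (Psi (2 * p + 1) a b).ncard = 2 ^ p := by
  rw [← (ncard_isTailWord hab p).2,
    ← Set.ncard_image_of_injective {s | s.length = 2 * p ∧ IsTailWord a b s}
      (List.cons_injective (a := a))]
  congr 1
  ext t
  rw [mem_Psi hab]
  constructor
  · rintro ⟨hl, s, rfl, hs⟩
    exact ⟨s, ⟨by simpa using hl, hs⟩, rfl⟩
  · rintro ⟨s, ⟨hl, hs⟩, rfl⟩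
    exact ⟨by simp [hl], s, rfl, hs⟩

/-! ### The upper bound for odd `k` -/

/-- The largest value of (letters other than `a`) + (disjoint factors `aa`), computed greedily from
the left: an `a` forms a unit with the letter behind it, which contributes one whether that letter
is `a` or not, and every other letter contributes one by itself. For a word `s` over `{m, m + 1}`
no string is further away from `s` than `m * s.length + excess m s` in the Pell graph with
`k = 2 * m + 1`. -/
def excess (a : ℕ) : List ℕ → ℕ
  | [] => 0
  | [x] => if x = a then 0 else 1
  | x :: y :: s => if x = a then 1 + excess a s else 1 + excess a (y :: s)

theorem excess_cons_of_ne {a x : ℕ} (hx : x ≠ a) (s : List ℕ) :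
    excess a (x :: s) = 1 + excess a s := by
  cases s <;> simp [excess, hx]

theorem excess_cons_cons (a y : ℕ) (s : List ℕ) : excess a (a :: y :: s) = 1 + excess a s := by
  simp [excess]

theorem excess_le_cons (a : ℕ) (s : List ℕ) :
    excess a s ≤ excess a (a :: s) ∧ excess a (a :: s) ≤ 1 + excess a s := by
  induction s with
  | nil => simp [excess]
  | cons y s ih =>
    rw [excess_cons_cons]
    by_cases hy : y = a
    · subst hy; omega
    · rw [excess_cons_of_ne hy]; omega

theorem excess_isTailWord {a b : ℕ} (hab : a ≠ b) {s : List ℕ} (hs : IsTailWord a b s) :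
    2 * excess a s = s.length ∧ 2 * excess a (a :: s) = s.length := by
  induction hs with
  | nil => simp [excess]
  | aa _ ih => simp only [excess_cons_cons, List.length_cons]; omega
  | ba _ ih =>
    simp only [excess_cons_cons, excess_cons_of_ne hab.symm, List.length_cons]
    omega

theorem excess_isPhiWord {a b : ℕ} (hab : a ≠ b) {s : List ℕ} (hs : IsPhiWord a b s) :
    2 * excess a s = s.length := by
  induction hs with
  | tail h => exact (excess_isTailWord hab h).1
  | aa _ ih => simp only [excess_cons_cons, List.length_cons]; omega
  | ab _ ih => simp only [excess_cons_cons, List.length_cons]; omega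

theorem exists_path_of_excess {m : ℕ} (hm : 1 ≤ m) {s t : List ℕ}
    (hs : ∀ x ∈ s, x = m ∨ x = m + 1) (ht : IsPellString (2 * m + 1) t)
    (hl : s.length = t.length) :
    ∃ N ≤ m * t.length + excess m s, PellPath (2 * m + 1) N s t := by
  have hp : ∀ {s : List ℕ}, (∀ x ∈ s, x = m ∨ x = m + 1) → IsPellString (2 * m + 1) s :=
    fun hs => isPellString_of_forall_lt fun x hx => by have := hs x hx; omega
  induction ht generalizing s with
  | nil => exact ⟨0, by simp, by rw [List.length_eq_zero_iff.1 hl]; exact .refl _⟩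
  | @cons i t hi ht ih =>
    match s with
    | x :: s =>
      simp only [List.mem_cons, forall_eq_or_imp] at hs
      obtain ⟨N, hN, hpath⟩ := ih hs.2 (by simpa using hl)
      refine ⟨_, ?_, hpath.cons_cons (by omega) hi (hp hs.2)⟩
      simp only [List.length_cons, mul_add, mul_one]
      rcases hs.1 with rfl | rfl
      · have := excess_le_cons x s
        omega
      · rw [excess_cons_of_ne (by omega)]
        omega
  | @double t ht ih =>
    match s with
    | x :: y :: s =>
      simp only [List.mem_cons, forall_eq_or_imp] at hs
      obtain ⟨N, hN, hpath⟩ := ih hs.2.2 (by simpa using hl)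
      refine ⟨_, ?_, hpath.cons_double (by omega) (by omega) (hp hs.2.2)⟩
      simp only [List.length_cons, mul_add, mul_one]
      rcases hs.1 with rfl | rfl
      · rw [excess_cons_cons]
        omega
      · rw [excess_cons_of_ne (by omega)]
        rcases hs.2.1 with rfl | rfl
        · have := excess_le_cons y s
          omega
        · rw [excess_cons_of_ne (by omega)]
          omega

/-! ### The lower bound for odd `k` -/

theorem IsPellString.eq_or_double {k x : ℕ} {s : List ℕ} (h : IsPellString k (x :: s)) :
    (x < k ∧ IsPellString k s) ∨ ∃ r, x = k ∧ s = k :: r ∧ IsPellString k r := by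
  cases h with
  | cons h1 h2 => exact .inl ⟨h1, h2⟩
  | double h => exact .inr ⟨_, rfl, rfl, h⟩

theorem hasFar_add_half {m : ℕ} (hm : 1 ≤ m) : ∀ {s : List ℕ}, IsPellString (2 * m + 1) s →
    HasFar (2 * m + 1) s (m * s.length + s.length / 2)
  | [], _ => by simpa using HasFar.nil (2 * m + 1)
  | [x], hs => by
    rcases hs.eq_or_double with ⟨hx, hs⟩ | ⟨r, -, h, -⟩
    · refine ((HasFar.nil _).cons hx).mono ?_
      simp only [List.length_cons, List.length_nil]
      omega
    · simp at h
  | x :: y :: s, hs => by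
    rcases hs.eq_or_double with ⟨hx, hs⟩ | ⟨r, rfl, h, hr⟩
    · rcases hs.eq_or_double with ⟨hy, hs'⟩ | ⟨r, rfl, rfl, hr⟩
      · have ih := hasFar_add_half hm hs'
        by_cases hxy : x ≤ m ∧ y ≤ m
        · refine (ih.cons_cons hx hy).mono ?_
          simp only [List.length_cons, mul_add, mul_one]
          omega
        · refine ((ih.cons hy).cons hx).mono ?_
          simp only [List.length_cons, mul_add, mul_one]
          omega
      · refine (((hasFar_add_half hm hr).double (by omega)).cons hx).mono ?_
        simp only [List.length_cons, mul_add, mul_one]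
        omega
    · simp only [List.cons.injEq] at h
      obtain ⟨rfl, rfl⟩ := h
      refine ((hasFar_add_half hm hr).double (by omega)).mono ?_
      simp only [List.length_cons, mul_add, mul_one]
      omega

/-- A string of even length attains the bound of `hasFar_add_half` only if it is a word of
`IsPhiWord`, one of odd length only if it is `m` followed by a word of `IsTailWord`. Both
statements are proved together, by removing one or two letters in front. -/
theorem center_word_or_hasFar {m : ℕ} (hm : 1 ≤ m) {s : List ℕ}
    (hs : IsPellString (2 * m + 1) s) :
    (Even s.length → IsPhiWord m (m + 1) s ∨
      HasFar (2 * m + 1) s (m * s.length + s.length / 2 + 1)) ∧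
    (Odd s.length → (∃ r, s = m :: r ∧ IsTailWord m (m + 1) r) ∨
      HasFar (2 * m + 1) s (m * s.length + s.length / 2 + 1)) := by
  induction hn : s.length using Nat.strong_induction_on generalizing s with
  | _ n IH =>
  subst hn
  match s with
  | [] => exact ⟨fun _ => .inl (.tail .nil), fun h => by simp at h⟩
  | x :: s =>
    rcases hs.eq_or_double with ⟨hx, hs⟩ | ⟨r, rfl, rfl, hr⟩
    swap
    · have hfar := (hasFar_add_half hm hr).double (show 0 < 2 * m + 1 by omega)
      constructor <;> intro _ <;> right <;> refine hfar.mono ?_ <;>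
        simp only [List.length_cons, mul_add, mul_one] <;> omega
    have hfar := hasFar_add_half hm hs
    have ih := IH s.length (by simp) hs rfl
    constructor
    · intro he
      have ho : Odd s.length := by simpa [parity_simps] using he
      rcases ih.2 ho with ⟨r, rfl, hr⟩ | hfar'
      · -- the letter in front of `m :: r` has to be `m` or `m + 1`
        have hr' := (hs.of_append_cons (u := []) (by omega)).2
        rcases lt_trichotomy x m with hlt | rfl | hgt
        · right
          refine ((hasFar_add_half hm hr').cons_cons hx (by omega)).mono ?_
          simp only [List.length_cons, mul_add, mul_one]
          omega
        · exact .inl (.tail hr.aa)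
        · obtain rfl | hgt : x = m + 1 ∨ m + 1 < x := by omega
          · exact .inl (.tail hr.ba)
          · right
            refine (hfar.cons hx).mono ?_
            have := Nat.odd_iff.1 ho
            simp only [List.length_cons, mul_add, mul_one] at this ⊢
            omega
      · match s with
        | [] => simp at ho
        | y :: r =>
          have hr2 := Nat.odd_iff.1 ho
          by_cases hxm : x = m
          swap
          · right
            refine (hfar'.cons hx).mono ?_
            simp only [List.length_cons, mul_add, mul_one] at hr2 ⊢
            omega
          subst hxm
          rcases hs.eq_or_double with ⟨hy, hr⟩ | ⟨r', rfl, rfl, hr⟩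
          swap
          · right
            refine (((hasFar_add_half hm hr).double (by omega)).cons hx).mono ?_
            simp only [List.length_cons, mul_add, mul_one] at hr2 ⊢
            omega
          have ih' := (IH r.length (by simp) hr rfl).1
            (by simpa [parity_simps] using he)
          have hfr := hasFar_add_half hm hr
          rcases ih' with hphi | hf
          · obtain hy' | rfl | rfl | hy' : y < x ∨ y = x ∨ y = x + 1 ∨ x + 1 < y := by omega
            · right
              refine (hfr.cons_cons hx hy).mono ?_
              simp only [List.length_cons, mul_add, mul_one] at hr2 ⊢
              omega
            · exact .inl hphi.aa
            · exact .inl hphi.ab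
            · right
              refine ((hfr.cons hy).cons hx).mono ?_
              simp only [List.length_cons, mul_add, mul_one] at hr2 ⊢
              omega
          · right
            rcases le_or_gt y x with hyx | hyx
            · refine (hf.cons_cons hx hy).mono ?_
              simp only [List.length_cons, mul_add, mul_one] at hr2 ⊢
              omega
            · refine ((hf.cons hy).cons hx).mono ?_
              simp only [List.length_cons, mul_add, mul_one] at hr2 ⊢
              omega
    · intro ho
      have he : Even s.length := by simpa [parity_simps] using ho
      have he2 := Nat.even_iff.1 he
      rcases ih.1 he with hphi | hfar'
      swap
      · right
        refine (hfar'.cons hx).mono ?_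
        simp only [List.length_cons, mul_add, mul_one]
        omega
      by_cases hxm : x = m
      swap
      · right
        refine (hfar.cons hx).mono ?_
        simp only [List.length_cons, mul_add, mul_one]
        omega
      subst hxm
      -- the first pair of `s` may be exchanged with `x`, which yields the pair `xx`, followed
      -- by a shorter string of odd length
      cases hphi with
      | tail h => exact .inl ⟨s, rfl, h⟩
      | @aa r h =>
        have hr := (hs.of_append_cons (u := []) hx).2
        rcases (IH (x :: r).length (by simp) hr rfl).2
          (by simpa [parity_simps] using ho) with ⟨r', hr', h'⟩ | hf
        · simp only [List.cons.injEq, true_and] at hr'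
          exact .inl ⟨_, rfl, hr' ▸ h'.aa⟩
        · right
          refine (hf.cons_cons hx hx).mono ?_
          simp only [List.length_cons, mul_add, mul_one]
          omega
      | @ab r h =>
        have hr := (hs.of_append_cons (u := []) hx).2
        rcases (IH ((x + 1) :: r).length (by simp) hr rfl).2
          (by simpa [parity_simps] using ho) with ⟨r', hr', h'⟩ | hf
        · simp at hr'
        · right
          refine (hf.cons_cons hx hx).mono ?_
          simp only [List.length_cons, mul_add, mul_one]
          omega

/-! ### The center for odd `k` -/

theorem center_eq_Phi {p m : ℕ} (hm : 1 ≤ m) :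
    Subtype.val '' (pellGraph (2 * p) (2 * m + 1)).center = Phi (2 * p) m (m + 1) := by
  have hab : m ≠ m + 1 := by omega
  refine center_eq (R := m * (2 * p) + p) (by omega) ?_ ?_ ?_ ?_
  · by_contra h
    have := ncard_Phi hab p
    rw [Set.not_nonempty_iff_eq_empty.1 h] at this
    simp at this
  · intro s hs
    rw [mem_Phi hab] at hs
    exact ⟨isPellString_of_forall_lt fun x hx => by have := hs.2.mem x hx; omega, hs.1⟩
  · intro s hs t ht
    rw [mem_Phi hab] at hs
    obtain ⟨N, hN, hp⟩ := exists_path_of_excess hm hs.2.mem ht.1 (hs.1.trans ht.2.symm)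
    refine ⟨N, hN.trans ?_, hp⟩
    have := excess_isPhiWord hab hs.2
    rw [hs.1] at this
    rw [ht.2]
    omega
  · rintro s ⟨hs, hl⟩
    rcases (center_word_or_hasFar hm hs).1 (hl ▸ even_two_mul p) with h1 | ⟨t, h1, h2, h3⟩
    · obtain ⟨t, h2, h3, h4⟩ := hasFar_add_half hm hs
      refine ⟨t, ⟨h2, h3.trans hl⟩, ?_, fun hn => (hn ((mem_Phi hab).2 ⟨hl, h1⟩)).elim⟩
      rw [hl] at h4
      omega
    · rw [hl] at h3
      exact ⟨t, ⟨h1, h2.trans hl⟩, by omega, fun _ => by omega⟩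

theorem center_eq_Psi {p m : ℕ} (hm : 1 ≤ m) :
    Subtype.val '' (pellGraph (2 * p + 1) (2 * m + 1)).center = Psi (2 * p + 1) m (m + 1) := by
  have hab : m ≠ m + 1 := by omega
  have hmem : ∀ {s}, s ∈ Psi (2 * p + 1) m (m + 1) → ∀ x ∈ s, x = m ∨ x = m + 1 :=
    fun hs => hs.2.1
  refine center_eq (R := m * (2 * p + 1) + p) (by omega) ?_ ?_ ?_ ?_
  · by_contra h
    have := ncard_Psi hab p
    rw [Set.not_nonempty_iff_eq_empty.1 h, Set.ncard_empty] at this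
    exact (Nat.two_pow_pos p).ne this
  · intro s hs
    exact ⟨isPellString_of_forall_lt fun x hx => by have := hmem hs x hx; omega, hs.1⟩
  · intro s hs t ht
    obtain ⟨N, hN, hp⟩ := exists_path_of_excess hm (hmem hs) ht.1 (hs.1.trans ht.2.symm)
    refine ⟨N, hN.trans ?_, hp⟩
    obtain ⟨hl, r, rfl, hr⟩ := (mem_Psi hab).1 hs
    have := (excess_isTailWord hab hr).2
    simp only [List.length_cons] at hl
    rw [ht.2]
    omega
  · rintro s ⟨hs, hl⟩
    rcases (center_word_or_hasFar hm hs).2 (hl ▸ odd_two_mul_add_one p) with h1 | ⟨t, h1, h2, h3⟩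
    · obtain ⟨t, h2, h3, h4⟩ := hasFar_add_half hm hs
      refine ⟨t, ⟨h2, h3.trans hl⟩, ?_, fun hn => (hn ((mem_Psi hab).2 ⟨hl, h1⟩)).elim⟩
      rw [hl] at h4
      omega
    · rw [hl] at h3
      exact ⟨t, ⟨h1, h2.trans hl⟩, by omega, fun _ => by omega⟩

theorem ncard_center_eq {n k : ℕ} {C : Set (List ℕ)}
    (h : Subtype.val '' (pellGraph n k).center = C) :
    (pellGraph n k).center.ncard = C.ncard := by
  rw [← h, Set.ncard_image_of_injective _ Subtype.val_injective]

end KPell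

theorem mainTheorem1 (n k : ℕ) (hn : 2 ≤ n) (hk : 2 ≤ k) :
    (Even k →
      Subtype.val '' (KPell.pellGraph n k).center = KPell.Theta n k ∧
      (KPell.pellGraph n k).center.ncard = Nat.fib (n + 2) ∧
      Nonempty ((KPell.pellGraph n k).induce (KPell.pellGraph n k).center ≃g
        KPell.fibonacciCube n)) ∧
    (Odd k → Even n →
      Subtype.val '' (KPell.pellGraph n k).center = KPell.Phi n ((k - 1) / 2) ((k + 1) / 2) ∧
      ((KPell.pellGraph n k).center.ncard : ℚ) =
        ((n : ℚ) + 4) * (2 : ℚ) ^ ((n : ℤ) / 2 - 2)) ∧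
    (Odd k → Odd n →
      Subtype.val '' (KPell.pellGraph n k).center = KPell.Psi n ((k - 1) / 2) ((k + 1) / 2) ∧
      (KPell.pellGraph n k).center.ncard = 2 ^ ((n - 1) / 2)) := by
  refine ⟨?_, ?_, ?_⟩
  · intro he
    obtain ⟨h, rfl⟩ := even_iff_two_dvd.1 he
    have hh : 1 ≤ h := by omega
    have hC := KPell.center_eq_Theta (n := n) hh
    exact ⟨hC, (KPell.ncard_center_eq hC).trans (KPell.ncard_Theta hh),
      KPell.nonempty_iso_fibonacciCube hh⟩
  · rintro ⟨m, rfl⟩ hev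
    obtain ⟨p, rfl⟩ := even_iff_two_dvd.1 hev
    have hC := KPell.center_eq_Phi (p := p) (m := m) (by omega)
    have h1 : (2 * m + 1 - 1) / 2 = m := by omega
    have h2 : (2 * m + 1 + 1) / 2 = m + 1 := by omega
    rw [h1, h2]
    refine ⟨hC, ?_⟩
    have h3 := KPell.ncard_Phi (show m ≠ m + 1 by omega) p
    rw [← KPell.ncard_center_eq hC] at h3
    have h4 : (((2 * p : ℕ) : ℤ) / 2 - 2) = (p : ℤ) - 2 := by omega
    have h5 : (2 : ℚ) * (KPell.pellGraph (2 * p) (2 * m + 1)).center.ncard =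
        ((p : ℚ) + 2) * 2 ^ p := by exact_mod_cast h3
    rw [h4, zpow_sub₀ two_ne_zero, zpow_natCast, zpow_ofNat]
    push_cast
    linear_combination h5 / 2
  · rintro ⟨m, rfl⟩ ⟨p, rfl⟩
    have hC := KPell.center_eq_Psi (p := p) (m := m) (by omega)
    have h1 : (2 * m + 1 - 1) / 2 = m := by omega
    have h2 : (2 * m + 1 + 1) / 2 = m + 1 := by omega
    have h3 : (2 * p + 1 - 1) / 2 = p := by omega
    rw [h1, h2, h3]
    exact ⟨hC, (KPell.ncard_center_eq hC).trans (KPell.ncard_Psi (by omega) p)⟩
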